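/- Let $H^1$ be the Sobolev space of real functions $u\in L^2(\mathbb R)$ with weak derivative $u'\in L^2(\mathbb R)$, let $G(x,y)=\tfrac12(|x|+|y|-|x-y|)$ (which is $\min\{|x|,|y|\}$ if $xy>0$ and $0$ otherwise), and put $$\mathcal X_1=\Big\{u\in H^1:\ \int_{\mathbb R}|x|\,u(x)^2\,dx<\infty,\ \|u\|_2=1\Big\},\qquad \mathcal B_1=\Big\{u\in H^1:\ \iint_{\mathbb R^2} G(x,y)\,u(x)^2u(y)^2\,dx\,dy<\infty,\ \|u\|_2=1\Big\}.$$ For a point charge of strength $z$ at the origin, let the energy be $$E[u]=\int_{\mathbb R}|u'(x)|^2\,dx+\frac12\iint_{\mathbb R^2}\big[z(|x|+|y|)-|x-y|\big]\,u(x)^2\,u(y)^2\,dx\,dy$$ (for $u\in\mathcal X_1$ this equals $\int|u'|^2-\frac12\iint|x-y|\,u(x)^2u(y)^2\,dx\,dy+z\int|x|\,u(x)^2\,dx$). Let $u$ be a minimiser of $E$ in $\mathcal X_1$ if $z>1$, or in $\mathcal B_1$ if $z=1$. Then, up to a global sign, $u$ is symmetric nonincreasing: there is a continuous function $v\ge 0$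 which is even and nonincreasing on $[0,\infty)$ such that $u=v$ almost everywhere or $u=-v$ almost everywhere. -/

import Mathlib

open MeasureTheory Filter Set
open scoped ContDiff

namespace HydrogenLikeAtom

/-- `g` is a weak derivative of `u` on the real line. -/
def IsWeakDeriv (u g : ℝ → ℝ) : Prop :=
  LocallyIntegrable u ∧ LocallyIntegrable g ∧
    ∀ φ : ℝ → ℝ, ContDiff ℝ ∞ φ → HasCompactSupport φ →
      ∫ x, u x * deriv φ x = -∫ x, g x * φ x

/-- The Sobolev space `H¹(ℝ)` of real functions (not identified up to null sets): `u` is square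
integrable and has a square integrable weak derivative. -/
def H1 : Set (ℝ → ℝ) :=
  {u | MemLp u 2 ∧ ∃ g, MemLp g 2 ∧ IsWeakDeriv u g}

open Classical in
/-- The weak derivative `u'` of `u ∈ H¹(ℝ)`, which is unique up to null sets
(and the zero function if `u ∉ H¹(ℝ)`). -/
noncomputable def weakDeriv (u : ℝ → ℝ) : ℝ → ℝ :=
  if h : ∃ g, MemLp g 2 ∧ IsWeakDeriv u g then h.choose else 0

/-- The kernel `G(x, y) = (|x| + |y| - |x - y|) / 2`, which is `min (|x|, |y|)` if `x y > 0` and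
`0` otherwise. -/
noncomputable def G (x y : ℝ) : ℝ := (|x| + |y| - |x - y|) / 2

/-- The space `𝓧` of all `u ∈ H¹` with `∫ |x| u(x)² dx < ∞`. -/
def spaceX : Set (ℝ → ℝ) :=
  {u | u ∈ H1 ∧ Integrable fun x => |x| * u x ^ 2}

/-- The space `𝓑` of all `u ∈ H¹` with `∬ G(x, y) u(x)² u(y)² dx dy < ∞`
(the integrand is nonnegative). -/
def spaceB : Set (ℝ → ℝ) :=
  {u | u ∈ H1 ∧ Integrable fun p : ℝ × ℝ => G p.1 p.2 * u p.1 ^ 2 * u p.2 ^ 2}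

/-- `A₁`: the elements of `A` with `‖u‖₂ = 1`. -/
def normalized (A : Set (ℝ → ℝ)) : Set (ℝ → ℝ) :=
  {u | u ∈ A ∧ ∫ x, u x ^ 2 = 1}

/-- The potential energy `C[f] = ½ ∬ [z (|x| + |y|) - |x - y|] f(x) f(y) dx dy` in the field of a
point charge of strength `z` at the origin. -/
noncomputable def potentialEnergy (z : ℝ) (f : ℝ → ℝ) : ℝ :=
  1 / 2 * ∫ p : ℝ × ℝ, (z * (|p.1| + |p.2|) - |p.1 - p.2|) * f p.1 * f p.2

/-- The energy `E[u] = ‖u'‖₂² + C[u²]` for the background `-z δ₀`. In this form, unlike in the one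
with the three separate terms (see `energy_eq`), it makes sense on all of `𝓑₁` when `z = 1`. -/
noncomputable def energy (z : ℝ) (u : ℝ → ℝ) : ℝ :=
  (∫ x, weakDeriv u x ^ 2) + potentialEnergy z fun x => u x ^ 2

/-- A function on the line which is even and nonincreasing in `|x|`. -/
def IsSymmNonincreasing (v : ℝ → ℝ) : Prop :=
  (∀ x, v (-x) = v x) ∧ AntitoneOn v (Ici 0)

/-- The kernel `G` is the one of the Coulomb problem on each half-line. -/
theorem G_eq (x y : ℝ) : G x y = if 0 < x * y then min |x| |y| else 0 := by
  unfold G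
  split_ifs with h
  · rcases mul_pos_iff.mp h with ⟨hx, hy⟩ | ⟨hx, hy⟩ <;> rcases le_total x y with hxy | hxy <;>
      grind
  · have hxy : (0 ≤ x ∧ y ≤ 0) ∨ (x ≤ 0 ∧ 0 ≤ y) := mul_nonpos_iff.mp (not_lt.mp h)
    grind

/-- On `𝓧₁` the energy is
`‖u'‖₂² - ½ ∬ |x - y| u(x)² u(y)² dx dy + z ∫ |x| u(x)² dx`, with all integrals absolutely
convergent. -/
theorem energy_eq (z : ℝ) {u : ℝ → ℝ} (hu : u ∈ normalized spaceX) :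
    Integrable (fun p : ℝ × ℝ => |p.1 - p.2| * u p.1 ^ 2 * u p.2 ^ 2) ∧
    energy z u = (∫ x, weakDeriv u x ^ 2)
      + 1 / 2 * (∫ p : ℝ × ℝ, -|p.1 - p.2| * u p.1 ^ 2 * u p.2 ^ 2)
      + z * ∫ x, |x| * u x ^ 2 := by
  obtain ⟨⟨⟨h2, -⟩, hx⟩, h1⟩ := hu
  have hi : Integrable fun x => u x ^ 2 := h2.integrable_sq
  have hA : Integrable (fun p : ℝ × ℝ => (|p.1| * u p.1 ^ 2) * u p.2 ^ 2) := hx.mul_prod hi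
  have hB : Integrable (fun p : ℝ × ℝ => u p.1 ^ 2 * (|p.2| * u p.2 ^ 2)) := hi.mul_prod hx
  have hD : Integrable (fun p : ℝ × ℝ => |p.1 - p.2| * u p.1 ^ 2 * u p.2 ^ 2) := by
    refine (hA.add hB).mono' ?_ (Eventually.of_forall fun p => ?_)
    · have h : AEStronglyMeasurable (fun p : ℝ × ℝ => |p.1 - p.2| * (u p.1 ^ 2 * u p.2 ^ 2)) :=
        (by fun_prop : Continuous fun p : ℝ × ℝ => |p.1 - p.2|).aestronglyMeasurable.mul
          (hi.mul_prod hi).aestronglyMeasurable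
      simpa only [mul_assoc] using h
    · have h := abs_sub p.1 p.2
      have h' : 0 ≤ u p.1 ^ 2 * u p.2 ^ 2 := by positivity
      rw [Real.norm_of_nonneg (by positivity)]
      simp only [Pi.add_apply]
      nlinarith
  refine ⟨hD, ?_⟩
  have eA : ∫ p : ℝ × ℝ, (|p.1| * u p.1 ^ 2) * u p.2 ^ 2 = ∫ x, |x| * u x ^ 2 := by
    have h := integral_prod_mul (μ := volume) (ν := volume)
      (fun x : ℝ => |x| * u x ^ 2) (fun y : ℝ => u y ^ 2)
    rw [h1, mul_one] at h
    exact h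
  have eB : ∫ p : ℝ × ℝ, u p.1 ^ 2 * (|p.2| * u p.2 ^ 2) = ∫ x, |x| * u x ^ 2 := by
    have h := integral_prod_mul (μ := volume) (ν := volume)
      (fun y : ℝ => u y ^ 2) (fun x : ℝ => |x| * u x ^ 2)
    rw [h1, one_mul] at h
    exact h
  have e : ∀ p : ℝ × ℝ, (z * (|p.1| + |p.2|) - |p.1 - p.2|) * u p.1 ^ 2 * u p.2 ^ 2
      = z * ((|p.1| * u p.1 ^ 2) * u p.2 ^ 2 + u p.1 ^ 2 * (|p.2| * u p.2 ^ 2))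
        - |p.1 - p.2| * u p.1 ^ 2 * u p.2 ^ 2 := fun p => by ring
  unfold energy potentialEnergy
  simp only [e, neg_mul]
  have hS : Integrable (fun p : ℝ × ℝ => z * ((|p.1| * u p.1 ^ 2) * u p.2 ^ 2
      + u p.1 ^ 2 * (|p.2| * u p.2 ^ 2))) := (hA.add hB).const_mul z
  rw [integral_sub hS hD, integral_const_mul, integral_add hA hB, eA, eB, integral_neg]
  ring

end HydrogenLikeAtom

/-!
For `‖u‖₂ = 1` the energy is `∫ u'² + (z - 1) ∫ |x| u² + ∬ G(x, y) u(x)² u(y)²`, with three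
nonnegative terms when `1 ≤ z`. Put `μ = u² dx`. By the layer cake formula
`∫ |x| dμ = ∫₀^∞ μ{|x| > r} dr` and
`∬ G dμ dμ = ∫₀^∞ (μ(r, ∞)² + μ(-∞, -r)²) dr ≥ ½ ∫₀^∞ μ{|x| > r}² dr`,
with equality if `μ` is even.

Polarize `|u|` at a point `a > 0`, that is, put the larger of the two values `|u|(x)` and
`|u|(2a - x)` to the left of `a`, and then replace the square of the result by its even part. This
raises neither the Dirichlet integral nor the exterior masses `μ{|x| > r}`. For a minimiser the
exterior masses must therefore stay the same for almost every `r`. But polarization lowers the mass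
of `{|x| > r}` unless `|u|(y) ≤ |u|(2a - y)` whenever `|2a - y| < r < y`. Hence
`|u|(y) ≤ |u|(x)` whenever `|x| < y`, and by reflection whenever `|x| < |y|`.
-/

open scoped ENNReal Topology

namespace HydrogenLikeAtom

/-! ### Weak derivatives and local absolute continuity -/

/-- Local absolute continuity, that is, absolute continuity on every compact interval. On the line
these functions are the representatives on which weak derivatives can be computed pointwise. -/
def IsLocAC (V : ℝ → ℝ) : Prop := ∀ a b, AbsolutelyContinuousOnInterval V a b

namespace IsLocAC

variable {V W : ℝ → ℝ}

theorem ae_differentiableAt (hV : IsLocAC V) : ∀ᵐ x, DifferentiableAt ℝ V x := by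
  have h : ∀ᵐ x, ∀ n : ℕ, x ∈ uIcc (-(n : ℝ)) n → DifferentiableAt ℝ V x :=
    ae_all_iff.2 fun n => (hV _ _).ae_differentiableAt
  filter_upwards [h] with x hx
  obtain ⟨n, hn⟩ := exists_nat_ge |x|
  exact hx n (Icc_subset_uIcc (abs_le.1 hn))

protected theorem continuous (hV : IsLocAC V) : Continuous V := by
  refine continuous_iff_continuousAt.2 fun x => ?_
  have h := (hV (x - 1) (x + 1)).continuousOn
  rw [uIcc_of_le (by linarith)] at h
  exact h.continuousAt (Icc_mem_nhds (by linarith) (by linarith))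

theorem intervalIntegrable_deriv (hV : IsLocAC V) (a b : ℝ) :
    IntervalIntegrable (deriv V) volume a b := (hV a b).intervalIntegrable_deriv

theorem locallyIntegrable_deriv (hV : IsLocAC V) : LocallyIntegrable (deriv V) := by
  refine locallyIntegrable_iff.2 fun K hK => ?_
  obtain ⟨R, hR⟩ := hK.isBounded.subset_closedBall 0
  rw [Real.closedBall_eq_Icc] at hR
  exact ((intervalIntegrable_iff' (by simp)).1 (hV.intervalIntegrable_deriv _ _)).mono_set
    (hR.trans Icc_subset_uIcc)

theorem of_abs_sub_le {A B : ℝ → ℝ} (hA : IsLocAC A) (hB : IsLocAC B)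
    (h : ∀ x y, |V x - V y| ≤ |A x - A y| + |B x - B y|) : IsLocAC V := by
  intro a b
  refine squeeze_zero (fun t => Finset.sum_nonneg fun i _ => dist_nonneg) (fun t => ?_)
    (by simpa using Tendsto.add (hA a b) (hB a b))
  rw [← Finset.sum_add_distrib]
  exact Finset.sum_le_sum fun i _ => h _ _

theorem const (c : ℝ) : IsLocAC fun _ => c := fun a b => by
  simpa [AbsolutelyContinuousOnInterval] using tendsto_const_nhds

theorem add (hV : IsLocAC V) (hW : IsLocAC W) : IsLocAC fun x => V x + W x :=
  fun a b => (hV a b).add (hW a b)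

theorem neg (hV : IsLocAC V) : IsLocAC fun x => -V x := fun a b => (hV a b).neg

theorem abs (hV : IsLocAC V) : IsLocAC fun x => |V x| :=
  hV.of_abs_sub_le hV fun _ _ =>
    (abs_abs_sub_abs_le _ _).trans (le_add_of_nonneg_left (abs_nonneg _))

theorem max (hV : IsLocAC V) (hW : IsLocAC W) : IsLocAC fun x => max (V x) (W x) :=
  hV.of_abs_sub_le hW fun _ _ => (abs_max_sub_max_le_max _ _ _ _).trans
    (max_le_add_of_nonneg (abs_nonneg _) (abs_nonneg _))

theorem min (hV : IsLocAC V) (hW : IsLocAC W) : IsLocAC fun x => min (V x) (W x) :=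
  hV.of_abs_sub_le hW fun _ _ => (abs_min_sub_min_le_max _ _ _ _).trans
    (max_le_add_of_nonneg (abs_nonneg _) (abs_nonneg _))

theorem primitive {g : ℝ → ℝ} (hg : ∀ a b, IntervalIntegrable g volume a b) (c : ℝ) :
    IsLocAC fun x => ∫ t in c..x, g t := by
  intro a b
  have hle : Min.min (Min.min a b) c ≤ Max.max (Max.max a b) c :=
    (min_le_right _ _).trans (le_max_right _ _)
  have h := hg (Min.min (Min.min a b) c) (Max.max (Max.max a b) c)
  refine (h.absolutelyContinuousOnInterval_intervalIntegral (c := c) ?_).mono ?_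
  · rw [uIcc_of_le hle]
    exact ⟨min_le_right _ _, le_max_right _ _⟩
  · rw [uIcc_of_le hle, uIcc]
    exact Icc_subset_Icc (min_le_left _ _) (le_max_left _ _)

theorem eq_add_integral_deriv (hV : IsLocAC V) (a x : ℝ) :
    V x = V a + ∫ t in a..x, deriv V t := by
  rw [(hV a x).integral_deriv_eq_sub, add_sub_cancel]

theorem comp_const_sub (hV : IsLocAC V) (c : ℝ) : IsLocAC fun x => V (c - x) := by
  have h : (fun x => V (c - x)) = fun x => V 0 + -∫ t in c..x, deriv V (c - t) := by
    funext x
    rw [intervalIntegral.integral_comp_sub_left (fun t => deriv V t), sub_self,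
      ← intervalIntegral.integral_symm]
    exact hV.eq_add_integral_deriv 0 (c - x)
  rw [h]
  refine (const _).add (primitive (fun a b => ?_) c).neg
  simpa only [sub_sub_cancel] using (hV.intervalIntegrable_deriv (c - a) (c - b)).comp_sub_left c

theorem comp_neg (hV : IsLocAC V) : IsLocAC fun x => V (-x) := by
  simpa only [zero_sub] using hV.comp_const_sub 0

theorem ite_le (hV : IsLocAC V) (hW : IsLocAC W) {a : ℝ} (ha : V a = W a) :
    IsLocAC fun x => if x ≤ a then V x else W x := by
  classical
  set g : ℝ → ℝ := (Iic a).piecewise (deriv V) (deriv W)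
  have hg : ∀ p q, IntervalIntegrable g volume p q := fun p q =>
    intervalIntegrable_iff.2 <| Integrable.piecewise measurableSet_Iic
      (intervalIntegrable_iff.1 (hV.intervalIntegrable_deriv p q)).integrableOn
      (intervalIntegrable_iff.1 (hW.intervalIntegrable_deriv p q)).integrableOn
  have h : (fun x => if x ≤ a then V x else W x) = fun x => V a + ∫ t in a..x, g t := by
    funext x
    split_ifs with hx
    · rw [hV.eq_add_integral_deriv a x]
      congr 1
      refine intervalIntegral.integral_congr fun t ht => (piecewise_eq_of_mem _ _ _ ?_).symm
      exact (uIcc_of_ge hx ▸ ht).2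
    · rw [hW.eq_add_integral_deriv a x, ha]
      congr 1
      refine intervalIntegral.integral_congr_uIoo fun t ht => ?_
      rw [uIoo_of_lt (not_le.1 hx)] at ht
      exact (piecewise_eq_of_notMem (Iic a) _ _ ht.1.not_ge).symm
  rw [h]
  exact (const _).add (primitive hg a)

end IsLocAC

theorem exists_tsupport_subset_Ioo {φ : ℝ → ℝ} (hφ : HasCompactSupport φ) :
    ∃ R, tsupport φ ⊆ Ioo (-R) R := by
  obtain ⟨R, -, h⟩ := hφ.isBounded.subset_ball_lt 0 0
  rw [Real.ball_eq_Ioo, zero_sub, zero_add] at h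
  exact ⟨R, h⟩

theorem exists_contDiff_hasCompactSupport_deriv_eq {k : ℝ → ℝ} (hk : ContDiff ℝ ∞ k)
    (hkc : HasCompactSupport k) (hk0 : ∫ x, k x = 0) :
    ∃ φ : ℝ → ℝ, ContDiff ℝ ∞ φ ∧ HasCompactSupport φ ∧ deriv φ = k := by
  obtain ⟨R, hkR⟩ := exists_tsupport_subset_Ioo hkc
  have hsupp : Function.support k ⊆ Ioo (-R) R := (subset_tsupport k).trans hkR
  set φ : ℝ → ℝ := fun x => ∫ t in (-R)..x, k t
  have hφ : ∀ x, HasDerivAt φ (k x) x := fun x =>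
    intervalIntegral.integral_hasDerivAt_right (hk.continuous.intervalIntegrable _ _)
      (hk.continuous.stronglyMeasurableAtFilter _ _) hk.continuous.continuousAt
  have hderiv : deriv φ = k := funext fun x => (hφ x).deriv
  refine ⟨φ, contDiff_infty_iff_deriv.2 ⟨fun x => (hφ x).differentiableAt, hderiv ▸ hk⟩, ?_, hderiv⟩
  refine HasCompactSupport.intro (isCompact_Icc (a := -R) (b := R)) fun x hx => ?_
  rw [mem_Icc, not_and_or, not_le, not_le] at hx
  rcases hx with hx | hx
  · refine intervalIntegral.integral_zero_ae (Eventually.of_forall fun t ht => ?_)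
    rw [uIoc_of_ge hx.le] at ht
    exact Function.notMem_support.1 fun h => (hsupp h).1.not_ge ht.2
  · have hsupp' : Function.support k ⊆ Ioc (-R) x :=
      hsupp.trans fun t ht => ⟨ht.1, ht.2.le.trans hx.le⟩
    exact (intervalIntegral.integral_eq_integral_of_support_subset hsupp').trans hk0

/-- The lemma of du Bois-Reymond. -/
theorem exists_ae_eq_const_of_integral_deriv_smul_eq_zero {E : Type*} [NormedAddCommGroup E]
    [NormedSpace ℝ E] [CompleteSpace E] {h : ℝ → E} (hh : LocallyIntegrable h)
    (h0 : ∀ φ : ℝ → ℝ, ContDiff ℝ ∞ φ → HasCompactSupport φ → ∫ x, deriv φ x • h x = 0) :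
    ∃ c, h =ᵐ[volume] fun _ => c := by
  let b : ContDiffBump (0 : ℝ) := default
  set β := b.normed volume
  have hβ : ContDiff ℝ ∞ β := b.contDiff_normed
  have hβc : HasCompactSupport β := b.hasCompactSupport_normed
  refine ⟨∫ x, β x • h x, ae_eq_of_integral_contDiff_smul_eq hh (locallyIntegrable_const _)
    fun ψ hψ hψc => ?_⟩
  set I := ∫ x, ψ x
  have hβi : Integrable β := hβ.continuous.integrable_of_hasCompactSupport hβc
  have hk0 : ∫ x, (ψ x - I * β x) = 0 := by
    rw [integral_sub (hψ.continuous.integrable_of_hasCompactSupport hψc) (hβi.const_mul _),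
      integral_const_mul, b.integral_normed, mul_one, sub_self]
  obtain ⟨φ, hφ, hφc, hφ'⟩ := exists_contDiff_hasCompactSupport_deriv_eq
    (hψ.sub (contDiff_const.mul hβ)) (hψc.sub hβc.mul_left) hk0
  have key := h0 φ hφ hφc
  simp only [hφ', sub_smul, mul_smul] at key
  rw [integral_sub (hh.integrable_smul_left_of_hasCompactSupport hψ.continuous hψc)
    ((hh.integrable_smul_left_of_hasCompactSupport hβ.continuous hβc).fun_smul I),
    integral_smul, sub_eq_zero] at key
  rw [key, integral_smul_const]

theorem IsWeakDeriv.ae_unique {u g k : ℝ → ℝ} (hg : IsWeakDeriv u g) (hk : IsWeakDeriv u k) :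
    g =ᵐ[volume] k := by
  refine ae_eq_of_integral_contDiff_smul_eq hg.2.1 hk.2.1 fun φ hφ hc => ?_
  simp only [smul_eq_mul, mul_comm (φ _)]
  exact neg_injective ((hg.2.2 φ hφ hc).symm.trans (hk.2.2 φ hφ hc))

theorem IsWeakDeriv.congr {u v g k : ℝ → ℝ} (hg : IsWeakDeriv u g) (huv : u =ᵐ[volume] v)
    (hgk : g =ᵐ[volume] k) : IsWeakDeriv v k := by
  refine ⟨hg.1.congr huv, hg.2.1.congr hgk, fun φ hφ hc => ?_⟩
  calc ∫ x, v x * deriv φ x = ∫ x, u x * deriv φ x :=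
        integral_congr_ae (huv.symm.mul EventuallyEq.rfl)
    _ = -∫ x, g x * φ x := hg.2.2 φ hφ hc
    _ = -∫ x, k x * φ x := congrArg Neg.neg (integral_congr_ae (hgk.mul EventuallyEq.rfl))

theorem IsWeakDeriv.exists_ae_eq_add_const {u v g : ℝ → ℝ} (hu : IsWeakDeriv u g)
    (hv : IsWeakDeriv v g) : ∃ c, u =ᵐ[volume] fun x => v x + c := by
  obtain ⟨c, hc⟩ := exists_ae_eq_const_of_integral_deriv_smul_eq_zero (hu.1.sub hv.1)
    fun φ hφ hφc => by
      have hφ' : Continuous (deriv φ) := hφ.continuous_deriv (by simp)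
      simp only [Pi.sub_apply, smul_sub]
      rw [integral_sub (hu.1.integrable_smul_left_of_hasCompactSupport hφ' hφc.deriv)
        (hv.1.integrable_smul_left_of_hasCompactSupport hφ' hφc.deriv)]
      simp only [smul_eq_mul, mul_comm (deriv φ _)]
      rw [hu.2.2 φ hφ hφc, hv.2.2 φ hφ hφc, sub_self]
  exact ⟨c, hc.mono fun x hx => sub_eq_iff_eq_add'.1 hx⟩

theorem IsLocAC.isWeakDeriv {V : ℝ → ℝ} (hV : IsLocAC V) : IsWeakDeriv V (deriv V) := by
  refine ⟨hV.continuous.locallyIntegrable, hV.locallyIntegrable_deriv, fun φ hφ hc => ?_⟩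
  obtain ⟨R, hφR⟩ := exists_tsupport_subset_Ioo hc
  have integral_eq : ∀ f : ℝ → ℝ, Function.support f ⊆ tsupport φ →
      ∫ x, f x = ∫ x in (-R)..R, f x := fun f hf =>
    (intervalIntegral.integral_eq_integral_of_support_subset
      (hf.trans (hφR.trans Ioo_subset_Ioc_self))).symm
  have hφ_right : φ R = 0 := image_eq_zero_of_notMem_tsupport fun h => (hφR h).2.false
  have hφ_left : φ (-R) = 0 := image_eq_zero_of_notMem_tsupport fun h => (hφR h).1.false
  have hφAC : AbsolutelyContinuousOnInterval φ (-R) R :=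
    (hφ.of_le (by simp) : ContDiff ℝ 1 φ).contDiffOn.absolutelyContinuousOnInterval
  rw [integral_eq _ ((Function.support_mul_subset_right _ _).trans support_deriv_subset),
    integral_eq _ ((Function.support_mul_subset_right _ _).trans (subset_tsupport φ)),
    (hV (-R) R).integral_mul_deriv_eq_deriv_mul hφAC, hφ_right, hφ_left]
  ring

theorem IsWeakDeriv.exists_isLocAC_ae_eq {u g : ℝ → ℝ} (hu : IsWeakDeriv u g) :
    ∃ V, IsLocAC V ∧ u =ᵐ[volume] V ∧ g =ᵐ[volume] deriv V := by
  set P : ℝ → ℝ := fun x => ∫ t in (0 : ℝ)..x, g t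
  have hP : IsLocAC P := IsLocAC.primitive (fun a b =>
    (hu.2.1.integrableOn_isCompact isCompact_uIcc).intervalIntegrable) 0
  have hP' : deriv P =ᵐ[volume] g :=
    (LocallyIntegrable.ae_hasDerivAt_integral hu.2.1).mono fun x hx => (hx 0).deriv
  obtain ⟨c, hc⟩ := hu.exists_ae_eq_add_const (hP.isWeakDeriv.congr EventuallyEq.rfl hP')
  refine ⟨fun x => P x + c, hP.add (IsLocAC.const c), hc, hP'.symm.trans ?_⟩
  exact Eventually.of_forall fun x => by rw [deriv_add_const]

theorem weakDeriv_spec {u : ℝ → ℝ} (hu : u ∈ H1) :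
    MemLp (weakDeriv u) 2 ∧ IsWeakDeriv u (weakDeriv u) := by
  rw [weakDeriv, dif_pos hu.2]
  exact hu.2.choose_spec

theorem weakDeriv_ae_eq {u g : ℝ → ℝ} (hu : u ∈ H1) (hg : IsWeakDeriv u g) :
    weakDeriv u =ᵐ[volume] g :=
  (weakDeriv_spec hu).2.ae_unique hg

theorem IsLocAC.mem_H1_iff {V : ℝ → ℝ} (hV : IsLocAC V) :
    V ∈ H1 ↔ MemLp V 2 ∧ MemLp (deriv V) 2 := by
  refine ⟨fun h => ⟨h.1, ?_⟩, fun h => ⟨h.1, _, h.2, hV.isWeakDeriv⟩⟩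
  exact (memLp_congr_ae (weakDeriv_ae_eq h hV.isWeakDeriv)).1 (weakDeriv_spec h).1

/-! ### Lattice operations, quadratic means and polarization -/

theorem sq_deriv_le_of_isLocalExtr_sub {f h : ℝ → ℝ} {x : ℝ} (hf : DifferentiableAt ℝ f x)
    (hx : IsLocalExtr (fun y => h y - f y) x) : deriv h x ^ 2 ≤ deriv f x ^ 2 := by
  by_cases hh : DifferentiableAt ℝ h x
  · have := hx.deriv_eq_zero
    rw [deriv_fun_sub hh hf, sub_eq_zero] at this
    rw [this]
  · rw [deriv_zero_of_not_differentiableAt hh, zero_pow two_ne_zero]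
    positivity

theorem sq_deriv_abs_le {f : ℝ → ℝ} {x : ℝ} (hf : DifferentiableAt ℝ f x) :
    deriv (fun y => |f y|) x ^ 2 ≤ deriv f x ^ 2 := by
  rcases le_total 0 (f x) with h | h
  · refine sq_deriv_le_of_isLocalExtr_sub hf (.inl (Eventually.of_forall fun y => ?_))
    simp only [abs_of_nonneg h, sub_self]
    exact sub_nonneg.2 (le_abs_self _)
  · rw [← neg_sq (deriv f x), ← deriv.fun_neg]
    refine sq_deriv_le_of_isLocalExtr_sub hf.fun_neg (.inl (Eventually.of_forall fun y => ?_))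
    simp only [abs_of_nonpos h, sub_self]
    exact sub_nonneg.2 (neg_le_abs _)

theorem sq_deriv_max_add_sq_deriv_min_le {f g : ℝ → ℝ} {x : ℝ} (hf : DifferentiableAt ℝ f x)
    (hg : DifferentiableAt ℝ g x) :
    deriv (fun y => max (f y) (g y)) x ^ 2 + deriv (fun y => min (f y) (g y)) x ^ 2 ≤
      deriv f x ^ 2 + deriv g x ^ 2 := by
  wlog h : g x ≤ f x generalizing f g
  · simpa only [max_comm, min_comm, add_comm] using this hg hf (le_of_not_ge h)
  refine add_le_add (sq_deriv_le_of_isLocalExtr_sub hf (.inl (Eventually.of_forall fun y => ?_)))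
    (sq_deriv_le_of_isLocalExtr_sub hg (.inr (Eventually.of_forall fun y => ?_)))
  · simp only [max_eq_left h, sub_self]
    exact sub_nonneg.2 (le_max_left _ _)
  · simp only [min_eq_right h, sub_self]
    exact sub_nonpos.2 (min_le_right _ _)

/-- The quadratic mean `√((V² + W²) / 2)` of two functions. -/
noncomputable def quadMean (V W : ℝ → ℝ) (x : ℝ) : ℝ := √((V x ^ 2 + W x ^ 2) / 2)

theorem sq_quadMean (V W : ℝ → ℝ) (x : ℝ) : quadMean V W x ^ 2 = (V x ^ 2 + W x ^ 2) / 2 :=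
  Real.sq_sqrt (by positivity)

theorem exists_sq_add_sq_eq_one_mul_add_mul_eq_sqrt (a b : ℝ) :
    ∃ c s : ℝ, c ^ 2 + s ^ 2 = 1 ∧ c * a + s * b = √(a ^ 2 + b ^ 2) := by
  set r := √(a ^ 2 + b ^ 2)
  have hr : r ^ 2 = a ^ 2 + b ^ 2 := Real.sq_sqrt (by positivity)
  by_cases h : r = 0
  · have ha : a = 0 := by nlinarith [sq_nonneg a, sq_nonneg b]
    have hb : b = 0 := by nlinarith [sq_nonneg a, sq_nonneg b]
    exact ⟨1, 0, by norm_num, by rw [ha, hb, h]; norm_num⟩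
  · refine ⟨a / r, b / r, ?_, ?_⟩
    · field_simp
      exact hr.symm
    · field_simp
      exact hr.symm

/- By Cauchy–Schwarz, `√2 * quadMean V W` is the upper envelope of the functions `c V + s W` with
`c ^ 2 + s ^ 2 = 1`; we differentiate the one which touches it at `x`. -/
theorem sq_deriv_quadMean_le {V W : ℝ → ℝ} {x : ℝ} (hV : DifferentiableAt ℝ V x)
    (hW : DifferentiableAt ℝ W x) :
    deriv (quadMean V W) x ^ 2 ≤ (deriv V x ^ 2 + deriv W x ^ 2) / 2 := by
  obtain ⟨c, s, hcs, htouch⟩ := exists_sq_add_sq_eq_one_mul_add_mul_eq_sqrt (V x) (W x)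
  have cauchy_schwarz : ∀ p q : ℝ, (c * p + s * q) ^ 2 ≤ p ^ 2 + q ^ 2 := fun p q => by
    linear_combination (p ^ 2 + q ^ 2) * hcs + sq_nonneg (c * q - s * p)
  set f : ℝ → ℝ := fun y => (c * V y + s * W y) / √2
  have hf : HasDerivAt f ((c * deriv V x + s * deriv W x) / √2) x :=
    ((hV.hasDerivAt.const_mul c).add (hW.hasDerivAt.const_mul s)).div_const _
  have hmin : IsLocalMin (fun y => quadMean V W y - f y) x := by
    refine Eventually.of_forall fun y => ?_
    have hx : quadMean V W x = f x := by
      rw [quadMean, Real.sqrt_div (by positivity), ← htouch]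
    have hy : f y ≤ quadMean V W y := by
      rw [quadMean, Real.sqrt_div (by positivity)]
      exact div_le_div_of_nonneg_right (Real.le_sqrt_of_sq_le (cauchy_schwarz _ _)) (by positivity)
    linarith
  calc deriv (quadMean V W) x ^ 2 ≤ deriv f x ^ 2 :=
        sq_deriv_le_of_isLocalExtr_sub hf.differentiableAt (.inl hmin)
    _ = (c * deriv V x + s * deriv W x) ^ 2 / 2 := by
        rw [hf.deriv, div_pow, Real.sq_sqrt zero_le_two]
    _ ≤ (deriv V x ^ 2 + deriv W x ^ 2) / 2 := by gcongr; exact cauchy_schwarz _ _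

theorem abs_quadMean_sub_le (V W : ℝ → ℝ) (x y : ℝ) :
    |quadMean V W x - quadMean V W y| ≤ |V x - V y| + |W x - W y| := by
  have norm_eq : ∀ x, quadMean V W x = ‖(⟨V x, W x⟩ : ℂ)‖ / √2 := fun x => by
    rw [quadMean, Real.sqrt_div (by positivity), Complex.norm_eq_sqrt_sq_add_sq]
  rw [norm_eq, norm_eq, ← sub_div, abs_div, abs_of_pos (by positivity : 0 < √2)]
  calc _ ≤ |‖(⟨V x, W x⟩ : ℂ)‖ - ‖(⟨V y, W y⟩ : ℂ)‖| :=
        div_le_self (abs_nonneg _) (Real.one_le_sqrt.2 one_le_two)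
    _ ≤ ‖(⟨V x, W x⟩ : ℂ) - ⟨V y, W y⟩‖ := abs_norm_sub_norm_le _ _
    _ ≤ |V x - V y| + |W x - W y| := Complex.norm_le_abs_re_add_abs_im _

theorem IsLocAC.quadMean {V W : ℝ → ℝ} (hV : IsLocAC V) (hW : IsLocAC W) :
    IsLocAC (quadMean V W) :=
  hV.of_abs_sub_le hW (abs_quadMean_sub_le V W)

/-- The polarization (two-point rearrangement) of `f` at the point `a`: of the two values
`f x` and `f (2 * a - x)`, the larger one is put to the left of `a`. -/
noncomputable def polarize {α : Type*} [LinearOrder α] (a : ℝ) (f : ℝ → α) (x : ℝ) : α :=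
  if x ≤ a then max (f x) (f (2 * a - x)) else min (f x) (f (2 * a - x))

section Polarize

variable {α β : Type*} [LinearOrder α] [LinearOrder β] {a x : ℝ} {f : ℝ → α}

theorem polarize_of_lt (h : a < x) : polarize a f x = min (f x) (f (2 * a - x)) := if_neg h.not_ge

theorem polarize_reflect_of_lt (h : a < x) :
    polarize a f (2 * a - x) = max (f x) (f (2 * a - x)) := by
  rw [polarize, if_pos (by linarith), sub_sub_cancel, max_comm]

theorem polarize_comp_of_monotoneOn {φ : α → β} {s : Set α} (hφ : MonotoneOn φ s)
    (hf : ∀ x, f x ∈ s) : polarize a (φ ∘ f) = φ ∘ polarize a f := by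
  funext x
  simp only [polarize, Function.comp_apply]
  split_ifs
  · exact (hφ.map_max (hf _) (hf _)).symm
  · exact (hφ.map_min (hf _) (hf _)).symm

end Polarize

theorem IsLocAC.polarize {V : ℝ → ℝ} (hV : IsLocAC V) (a : ℝ) : IsLocAC (polarize a V) := by
  have hR := hV.comp_const_sub (2 * a)
  refine (hV.max hR).ite_le (hV.min hR) ?_
  rw [two_mul, add_sub_cancel_right, max_self, min_self]

theorem measurable_polarize {f : ℝ → ℝ≥0∞} (hf : Measurable f) (a : ℝ) :
    Measurable (polarize a f) :=
  Measurable.ite measurableSet_Iic (by fun_prop) (by fun_prop)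

theorem lintegral_eq_setLIntegral_Ioi_add_reflect {f : ℝ → ℝ≥0∞} (hf : Measurable f) (a : ℝ) :
    ∫⁻ x, f x = ∫⁻ x in Ioi a, (f x + f (2 * a - x)) := by
  have reflect : ∫⁻ x in Iio a, f x = ∫⁻ x in Ioi a, f (2 * a - x) := by
    have h := (Measure.measurePreserving_sub_left volume (2 * a)).setLIntegral_comp_preimage
      measurableSet_Iio hf (s := Iio a)
    rw [preimage_const_sub_Iio, two_mul, add_sub_cancel_right] at h
    rw [← h, two_mul]
  rw [lintegral_add_left hf, ← lintegral_add_compl f (measurableSet_Ioi (a := a)), compl_Ioi,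
    ← restrict_Iio_eq_restrict_Iic, reflect]

/-- The Dirichlet integral `∫ (V')²`. -/
noncomputable def dirichlet (V : ℝ → ℝ) : ℝ≥0∞ := ∫⁻ x, ENNReal.ofReal (deriv V x ^ 2)

theorem measurable_ofReal_sq_deriv (V : ℝ → ℝ) :
    Measurable fun x => ENNReal.ofReal (deriv V x ^ 2) :=
  ((measurable_deriv V).pow_const 2).ennreal_ofReal

theorem dirichlet_comp_neg (V : ℝ → ℝ) : dirichlet (fun x => V (-x)) = dirichlet V := by
  simp only [dirichlet, deriv_comp_neg, neg_sq]
  exact lintegral_neg_eq_self fun x => ENNReal.ofReal (deriv V x ^ 2)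

theorem dirichlet_abs_le {V : ℝ → ℝ} (hV : IsLocAC V) :
    dirichlet (fun x => |V x|) ≤ dirichlet V :=
  lintegral_mono_ae <| hV.ae_differentiableAt.mono fun _ hx =>
    ENNReal.ofReal_le_ofReal (sq_deriv_abs_le hx)

theorem dirichlet_quadMean_le {V W : ℝ → ℝ} (hV : IsLocAC V) (hW : IsLocAC W) :
    dirichlet (quadMean V W) ≤ (dirichlet V + dirichlet W) / 2 := by
  simp only [dirichlet, ENNReal.div_eq_inv_mul]
  rw [← lintegral_add_left (measurable_ofReal_sq_deriv V),
    ← lintegral_const_mul' _ _ (by simp)]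
  refine lintegral_mono_ae ?_
  filter_upwards [hV.ae_differentiableAt, hW.ae_differentiableAt] with x hVx hWx
  rw [← ENNReal.ofReal_add (by positivity) (by positivity), ← ENNReal.div_eq_inv_mul]
  refine (ENNReal.ofReal_le_ofReal (sq_deriv_quadMean_le hVx hWx)).trans_eq ?_
  rw [ENNReal.ofReal_div_of_pos two_pos, ENNReal.ofReal_ofNat]

theorem dirichlet_polarize_le {V : ℝ → ℝ} (hV : IsLocAC V) (a : ℝ) :
    dirichlet (polarize a V) ≤ dirichlet V := by
  set R : ℝ → ℝ := fun x => V (2 * a - x)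
  set P := polarize a V
  have sq_deriv_reflect : ∀ (f : ℝ → ℝ) (x : ℝ),
      deriv f (2 * a - x) ^ 2 = deriv (fun y => f (2 * a - y)) x ^ 2 := fun f x => by
    rw [deriv_comp_const_sub, neg_sq]
  simp only [dirichlet, lintegral_eq_setLIntegral_Ioi_add_reflect (measurable_ofReal_sq_deriv _) a,
    ← ENNReal.ofReal_add (sq_nonneg _) (sq_nonneg _), sq_deriv_reflect]
  refine setLIntegral_mono_ae' measurableSet_Ioi ?_
  filter_upwards [hV.ae_differentiableAt, (hV.comp_const_sub (2 * a)).ae_differentiableAt]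
    with x hVx hRx hx
  have hP : P =ᶠ[𝓝 x] fun y => min (V y) (R y) :=
    (eventually_gt_nhds hx).mono fun _ => polarize_of_lt
  have hPR : (fun y => P (2 * a - y)) =ᶠ[𝓝 x] fun y => max (V y) (R y) :=
    (eventually_gt_nhds hx).mono fun _ => polarize_reflect_of_lt
  rw [hP.deriv_eq, hPR.deriv_eq, add_comm]
  exact ENNReal.ofReal_le_ofReal (sq_deriv_max_add_sq_deriv_min_le hVx hRx)

theorem setLIntegral_eq_setLIntegral_Ioi_add_reflect {f : ℝ → ℝ≥0∞} (hf : Measurable f)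
    {s : Set ℝ} (hs : MeasurableSet s) (a : ℝ) :
    ∫⁻ x in s, f x = ∫⁻ x in Ioi a, (s.indicator f x + s.indicator f (2 * a - x)) := by
  rw [← lintegral_indicator hs, lintegral_eq_setLIntegral_Ioi_add_reflect (hf.indicator hs)]

theorem lintegral_polarize {f : ℝ → ℝ≥0∞} (hf : Measurable f) (a : ℝ) :
    ∫⁻ x, polarize a f x = ∫⁻ x, f x := by
  rw [lintegral_eq_setLIntegral_Ioi_add_reflect (measurable_polarize hf a) a,
    lintegral_eq_setLIntegral_Ioi_add_reflect hf a]
  refine setLIntegral_congr_fun measurableSet_Ioi fun x hx => ?_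
  simp only [polarize_of_lt hx, polarize_reflect_of_lt hx, min_add_max]

section Polarize

variable {f : ℝ → ℝ≥0∞} {s : Set ℝ} {a : ℝ}

theorem indicator_polarize_add_reflect_le (hs : ∀ x, a < x → 2 * a - x ∈ s → x ∈ s) {x : ℝ}
    (hx : a < x) :
    s.indicator (polarize a f) x + s.indicator (polarize a f) (2 * a - x) ≤
      s.indicator f x + s.indicator f (2 * a - x) := by
  by_cases hr : 2 * a - x ∈ s
  · rw [indicator_of_mem (hs x hx hr), indicator_of_mem hr, indicator_of_mem (hs x hx hr),
      indicator_of_mem hr, polarize_of_lt hx, polarize_reflect_of_lt hx, min_add_max]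
  · rw [indicator_of_notMem hr, indicator_of_notMem hr]
    gcongr
    exact (polarize_of_lt hx).trans_le (min_le_left _ _)

theorem setLIntegral_polarize_le (hf : Measurable f) (hs : MeasurableSet s)
    (hsa : ∀ x, a < x → 2 * a - x ∈ s → x ∈ s) :
    ∫⁻ x in s, polarize a f x ≤ ∫⁻ x in s, f x := by
  rw [setLIntegral_eq_setLIntegral_Ioi_add_reflect (measurable_polarize hf a) hs a,
    setLIntegral_eq_setLIntegral_Ioi_add_reflect hf hs a]
  exact setLIntegral_mono' measurableSet_Ioi fun x => indicator_polarize_add_reflect_le hsa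

theorem ae_le_reflect_of_setLIntegral_le_polarize (hf : Measurable f) (hs : MeasurableSet s)
    (hsa : ∀ x, a < x → 2 * a - x ∈ s → x ∈ s) (hfin : ∫⁻ x in s, f x ≠ ⊤)
    (hle : ∫⁻ x in s, f x ≤ ∫⁻ x in s, polarize a f x) :
    ∀ᵐ x, a < x → x ∈ s → 2 * a - x ∉ s → f x ≤ f (2 * a - x) := by
  have hfin' := ne_top_of_le_ne_top hfin (setLIntegral_polarize_le hf hs hsa)
  rw [setLIntegral_eq_setLIntegral_Ioi_add_reflect (measurable_polarize hf a) hs a] at hle hfin'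
  rw [setLIntegral_eq_setLIntegral_Ioi_add_reflect hf hs a] at hle
  have : Measurable (s.indicator f) := hf.indicator hs
  have key := ae_eq_of_ae_le_of_lintegral_le
    (ae_restrict_of_forall_mem measurableSet_Ioi fun x => indicator_polarize_add_reflect_le hsa)
    hfin' (by fun_prop) hle
  filter_upwards [(ae_restrict_iff' measurableSet_Ioi).1 key] with x hx hax hxs hrs
  have hmin := hx hax
  rw [indicator_of_mem hxs, indicator_of_mem hxs, indicator_of_notMem hrs,
    indicator_of_notMem hrs, add_zero, add_zero, polarize_of_lt hax] at hmin
  exact min_eq_left_iff.1 hmin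

end Polarize

/-! ### Coulomb energy and exterior masses -/

theorem reflect_mem_exterior {a x r : ℝ} (ha : 0 ≤ a) (hx : a < x) (h : r < |2 * a - x|) :
    r < |x| := by
  refine h.trans_le (?_ : |2 * a - x| ≤ |x|)
  rw [abs_of_pos (by linarith : 0 < x), abs_le]
  constructor <;> linarith

theorem G_nonneg (x y : ℝ) : 0 ≤ G x y := by
  have := abs_sub x y
  unfold G
  linarith

theorem G_le_abs (x y : ℝ) : G x y ≤ |x| := by
  have := abs_sub_abs_le_abs_sub y x
  rw [abs_sub_comm] at this
  unfold G
  linarith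

theorem continuous_G : Continuous fun p : ℝ × ℝ => G p.1 p.2 := by
  unfold G
  fun_prop

theorem setOf_lt_G {r : ℝ} (hr : 0 ≤ r) :
    {p : ℝ × ℝ | r < G p.1 p.2} = Ioi r ×ˢ Ioi r ∪ Iio (-r) ×ˢ Iio (-r) := by
  ext ⟨x, y⟩
  simp only [mem_ofPred_eq, mem_union, mem_prod, mem_Ioi, mem_Iio, G_eq, mul_pos_iff]
  grind

theorem setOf_lt_abs (r : ℝ) : {x : ℝ | r < |x|} = Ioi r ∪ Iio (-r) := by
  ext x
  simp only [mem_ofPred_eq, lt_abs, mem_union, mem_Ioi, mem_Iio, lt_neg]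

theorem measurableSet_setOf_lt_abs (r : ℝ) : MeasurableSet {x : ℝ | r < |x|} :=
  measurableSet_lt measurable_const measurable_norm

/-- The Coulomb energy `∬ G(x, y) dμ(x) dμ(y)` of a charge distribution `μ` on the line. -/
noncomputable def coulomb (μ : Measure ℝ) : ℝ≥0∞ :=
  ∫⁻ p : ℝ × ℝ, ENNReal.ofReal (G p.1 p.2) ∂μ.prod μ

/-- The first absolute moment `∫ |x| dμ(x)`. -/
noncomputable def absMoment (μ : Measure ℝ) : ℝ≥0∞ := ∫⁻ x, ENNReal.ofReal |x| ∂μ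

section Coulomb

variable (μ : Measure ℝ)

theorem absMoment_eq_lintegral : absMoment μ = ∫⁻ r in Ioi 0, μ {x | r < |x|} :=
  lintegral_eq_lintegral_meas_lt μ (Eventually.of_forall abs_nonneg) (by fun_prop)

theorem measurable_measure_exterior : Measurable fun r => μ {x : ℝ | r < |x|} :=
  Antitone.measurable fun _ _ h => measure_mono fun _ hx => h.trans_lt hx

theorem measure_exterior {r : ℝ} (hr : 0 ≤ r) :
    μ {x | r < |x|} = μ (Ioi r) + μ (Iio (-r)) := by
  rw [setOf_lt_abs, measure_union (Ioi_disjoint_Iio_of_le (by linarith)) measurableSet_Iio]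

theorem measure_exterior_of_isNegInvariant [μ.IsNegInvariant] {r : ℝ} (hr : 0 ≤ r) :
    μ {x | r < |x|} = 2 * μ (Ioi r) := by
  rw [measure_exterior μ hr, ← neg_Ioi, Measure.measure_neg, two_mul]

theorem measure_neg_exterior (r : ℝ) : μ.neg {x | r < |x|} = μ {x | r < |x|} := by
  rw [Measure.neg_apply]
  simp only [Set.neg_ofPred, abs_neg]

theorem absMoment_neg : absMoment μ.neg = absMoment μ := by
  simp only [absMoment_eq_lintegral, measure_neg_exterior]

variable [SFinite μ]

theorem coulomb_eq_lintegral :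
    coulomb μ = ∫⁻ r in Ioi 0, (μ (Ioi r) ^ 2 + μ (Iio (-r)) ^ 2) := by
  rw [coulomb, lintegral_eq_lintegral_meas_lt (μ.prod μ)
    (Eventually.of_forall fun p => G_nonneg p.1 p.2) continuous_G.aemeasurable]
  refine setLIntegral_congr_fun measurableSet_Ioi fun r hr => ?_
  have hdisj : Disjoint (Ioi r ×ˢ Ioi r) (Iio (-r) ×ˢ Iio (-r)) :=
    disjoint_prod.2 (.inl (Ioi_disjoint_Iio_of_le (neg_le_self (le_of_lt hr))))
  rw [setOf_lt_G (le_of_lt hr), measure_union hdisj (measurableSet_Iio.prod measurableSet_Iio),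
    Measure.prod_prod, Measure.prod_prod, sq, sq]

theorem coulomb_neg : coulomb μ.neg = coulomb μ := by
  have : SFinite μ.neg := inferInstanceAs (SFinite (μ.map Neg.neg))
  simp only [coulomb_eq_lintegral, Measure.neg_apply, neg_Ioi, neg_Iio, neg_neg, add_comm]

theorem lintegral_sq_exterior_div_two_le_coulomb :
    ∫⁻ r in Ioi 0, μ {x | r < |x|} ^ 2 / 2 ≤ coulomb μ := by
  rw [coulomb_eq_lintegral]
  refine setLIntegral_mono' measurableSet_Ioi fun r hr => ENNReal.div_le_of_le_mul' ?_
  have h := ENNReal.rpow_add_le_mul_rpow_add_rpow (μ (Ioi r)) (μ (Iio (-r))) one_le_two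
  norm_num at h
  rwa [measure_exterior μ hr.le]

theorem coulomb_eq_lintegral_of_isNegInvariant [μ.IsNegInvariant] :
    coulomb μ = ∫⁻ r in Ioi 0, μ {x | r < |x|} ^ 2 / 2 := by
  rw [coulomb_eq_lintegral]
  refine setLIntegral_congr_fun measurableSet_Ioi fun r hr => ?_
  rw [measure_exterior_of_isNegInvariant μ hr.le, ← neg_Ioi, Measure.measure_neg,
    ENNReal.eq_div_iff two_ne_zero ENNReal.ofNat_ne_top]
  ring

end Coulomb

/-- The measure with density `V²`: the distribution of a particle with wave function `V`. -/
noncomputable def sqMeasure (V : ℝ → ℝ) : Measure ℝ :=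
  volume.withDensity fun x => ENNReal.ofReal (V x ^ 2)

instance (V : ℝ → ℝ) : SFinite (sqMeasure V) :=
  inferInstanceAs (SFinite (volume.withDensity _))

theorem sqMeasure_apply (V : ℝ → ℝ) (s : Set ℝ) :
    sqMeasure V s = ∫⁻ x in s, ENNReal.ofReal (V x ^ 2) := withDensity_apply' _ s

theorem sqMeasure_abs (V : ℝ → ℝ) : sqMeasure (fun x => |V x|) = sqMeasure V := by
  simp only [sqMeasure, sq_abs]

theorem sqMeasure_comp_neg (V : ℝ → ℝ) : sqMeasure (fun x => V (-x)) = (sqMeasure V).neg := by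
  ext s
  have h := (Measure.measurePreserving_neg (volume : Measure ℝ)).setLIntegral_comp_preimage_emb
    (MeasurableEquiv.neg ℝ).measurableEmbedding (fun x => ENNReal.ofReal (V x ^ 2)) (-s)
  rw [Measure.neg_apply, sqMeasure_apply, sqMeasure_apply, ← h, neg_preimage, neg_neg]

theorem sqMeasure_quadMean {V : ℝ → ℝ} (hV : Measurable V) (W : ℝ → ℝ) :
    sqMeasure (quadMean V W) = (2⁻¹ : ℝ≥0∞) • (sqMeasure V + sqMeasure W) := by
  have hsq : Measurable fun x => ENNReal.ofReal (V x ^ 2) := (hV.pow_const 2).ennreal_ofReal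
  rw [sqMeasure, sqMeasure, sqMeasure, ← withDensity_add_left hsq,
    ← withDensity_smul' _ _ (by simp)]
  congr 1
  funext x
  rw [sq_quadMean, ENNReal.ofReal_div_of_pos two_pos,
    ENNReal.ofReal_add (sq_nonneg _) (sq_nonneg _), ENNReal.ofReal_ofNat, ENNReal.div_eq_inv_mul]
  rfl

theorem sqMeasure_polarize {V : ℝ → ℝ} (hV : ∀ x, 0 ≤ V x) (a : ℝ) :
    sqMeasure (polarize a V) =
      volume.withDensity (polarize a fun x => ENNReal.ofReal (V x ^ 2)) := by
  have hmono : MonotoneOn (fun t : ℝ => ENNReal.ofReal (t ^ 2)) (Ici 0) :=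
    fun _ hs _ _ hst => ENNReal.ofReal_le_ofReal (pow_le_pow_left₀ hs hst 2)
  have hcomp := polarize_comp_of_monotoneOn (a := a) hmono hV
  simp only [Function.comp_def] at hcomp
  rw [sqMeasure, hcomp]

theorem sqMeasure_polarize_univ {V : ℝ → ℝ} (hV : Measurable V) (hV0 : ∀ x, 0 ≤ V x) (a : ℝ) :
    sqMeasure (polarize a V) univ = sqMeasure V univ := by
  rw [sqMeasure_polarize hV0, withDensity_apply' _ univ, sqMeasure_apply]
  simp only [Measure.restrict_univ]
  exact lintegral_polarize (hV.pow_const 2).ennreal_ofReal a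

theorem sqMeasure_polarize_exterior_le {V : ℝ → ℝ} (hV : Measurable V) (hV0 : ∀ x, 0 ≤ V x)
    {a : ℝ} (ha : 0 ≤ a) (r : ℝ) :
    sqMeasure (polarize a V) {x | r < |x|} ≤ sqMeasure V {x | r < |x|} := by
  rw [sqMeasure_polarize hV0, withDensity_apply' _ _, sqMeasure_apply]
  exact setLIntegral_polarize_le (hV.pow_const 2).ennreal_ofReal (measurableSet_setOf_lt_abs r)
    fun x => reflect_mem_exterior ha

/-- The even function whose square is the even part of `V²`. -/
noncomputable def symmetrize (V : ℝ → ℝ) : ℝ → ℝ := quadMean V fun x => V (-x)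

theorem IsLocAC.symmetrize {V : ℝ → ℝ} (hV : IsLocAC V) : IsLocAC (symmetrize V) :=
  hV.quadMean hV.comp_neg

theorem dirichlet_symmetrize_le {V : ℝ → ℝ} (hV : IsLocAC V) :
    dirichlet (symmetrize V) ≤ dirichlet V := by
  refine (dirichlet_quadMean_le hV hV.comp_neg).trans_eq ?_
  rw [dirichlet_comp_neg, ENNReal.add_div, ENNReal.add_halves]

theorem symmetrize_neg (V : ℝ → ℝ) (x : ℝ) : symmetrize V (-x) = symmetrize V x := by
  simp only [symmetrize, quadMean, neg_neg, add_comm]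

instance (V : ℝ → ℝ) : (sqMeasure (symmetrize V)).IsNegInvariant :=
  ⟨by rw [← sqMeasure_comp_neg, funext (symmetrize_neg V)]⟩

theorem sqMeasure_symmetrize_of_neg_eq {V : ℝ → ℝ} (hV : Measurable V) {s : Set ℝ}
    (hs : -s = s) : sqMeasure (symmetrize V) s = sqMeasure V s := by
  rw [symmetrize, sqMeasure_quadMean hV, sqMeasure_comp_neg, Measure.smul_apply,
    Measure.add_apply, Measure.neg_apply, hs, smul_eq_mul, ← two_mul, ← mul_assoc,
    ENNReal.inv_mul_cancel two_ne_zero ENNReal.ofNat_ne_top, one_mul]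

theorem sqMeasure_symmetrize_exterior {V : ℝ → ℝ} (hV : Measurable V) (r : ℝ) :
    sqMeasure (symmetrize V) {x | r < |x|} = sqMeasure V {x | r < |x|} :=
  sqMeasure_symmetrize_of_neg_eq hV (by simp only [Set.neg_ofPred, abs_neg])

/-! ### Minimisers are symmetric nonincreasing -/

/-- The energy of `V` as an extended nonnegative real, with the potential energy split into the
contribution of the excess charge `z - 1` and the Coulomb energy for the kernel `G`. For `z < 1` it
is not the energy, since `ENNReal.ofReal` truncates `z - 1` to `0`. -/
noncomputable def eenergy (z : ℝ) (V : ℝ → ℝ) : ℝ≥0∞ :=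
  dirichlet V + ENNReal.ofReal (z - 1) * absMoment (sqMeasure V) + coulomb (sqMeasure V)

/-- The locally absolutely continuous functions `V` with `‖V‖₂ = 1`. -/
def unitLocAC : Set (ℝ → ℝ) :=
  {V | IsLocAC V ∧ sqMeasure V univ = 1}

theorem eenergy_abs_le (z : ℝ) {V : ℝ → ℝ} (hV : IsLocAC V) :
    eenergy z (fun x => |V x|) ≤ eenergy z V := by
  unfold eenergy
  rw [sqMeasure_abs]
  gcongr
  exact dirichlet_abs_le hV

theorem eenergy_comp_neg (z : ℝ) (V : ℝ → ℝ) : eenergy z (fun x => V (-x)) = eenergy z V := by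
  unfold eenergy
  rw [dirichlet_comp_neg, sqMeasure_comp_neg, absMoment_neg, coulomb_neg]

theorem abs_mem_unitLocAC {V : ℝ → ℝ} (hV : V ∈ unitLocAC) : (fun x => |V x|) ∈ unitLocAC :=
  ⟨hV.1.abs, by rw [sqMeasure_abs, hV.2]⟩

theorem comp_neg_mem_unitLocAC {V : ℝ → ℝ} (hV : V ∈ unitLocAC) :
    (fun x => V (-x)) ∈ unitLocAC :=
  ⟨hV.1.comp_neg, by rw [sqMeasure_comp_neg, Measure.neg_apply, neg_univ, hV.2]⟩

theorem symmetrize_polarize_mem_unitLocAC {V : ℝ → ℝ} (hV : V ∈ unitLocAC)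
    (h0 : ∀ x, 0 ≤ V x) (a : ℝ) : symmetrize (polarize a V) ∈ unitLocAC :=
  ⟨(hV.1.polarize a).symmetrize, by
    rw [sqMeasure_symmetrize_of_neg_eq (hV.1.polarize a).continuous.measurable neg_univ,
      sqMeasure_polarize_univ hV.1.continuous.measurable h0, hV.2]⟩

theorem eenergy_symmetrize_polarize_le (z : ℝ) {V : ℝ → ℝ} (hV : IsLocAC V) (h0 : ∀ x, 0 ≤ V x)
    {a : ℝ} (ha : 0 ≤ a) :
    eenergy z (symmetrize (polarize a V)) ≤
      dirichlet V + ENNReal.ofReal (z - 1) * absMoment (sqMeasure V) +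
        ∫⁻ r in Ioi 0, sqMeasure (polarize a V) {x | r < |x|} ^ 2 / 2 := by
  have hP := hV.polarize a
  rw [eenergy, coulomb_eq_lintegral_of_isNegInvariant, absMoment_eq_lintegral,
    absMoment_eq_lintegral]
  simp only [sqMeasure_symmetrize_exterior hP.continuous.measurable]
  gcongr ?_ + _ * (∫⁻ r in Ioi 0, ?_) + _
  · exact (dirichlet_symmetrize_le hP).trans (dirichlet_polarize_le hV a)
  · exact sqMeasure_polarize_exterior_le hV.continuous.measurable h0 ha _

theorem le_reflect_of_exterior_le_polarize {V : ℝ → ℝ} (hV : Continuous V) (h0 : ∀ x, 0 ≤ V x)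
    {a r y : ℝ} (ha : 0 ≤ a) (hfin : sqMeasure V {x | r < |x|} ≠ ⊤)
    (hle : sqMeasure V {x | r < |x|} ≤ sqMeasure (polarize a V) {x | r < |x|})
    (hay : a < y) (hry : r < y) (hyr : |2 * a - y| < r) : V y ≤ V (2 * a - y) := by
  rw [sqMeasure_apply] at hfin hle
  rw [sqMeasure_polarize h0, withDensity_apply' _ _] at hle
  have hae := ae_le_reflect_of_setLIntegral_le_polarize
    (hV.measurable.pow_const 2).ennreal_ofReal (measurableSet_setOf_lt_abs r)
    (fun x => reflect_mem_exterior ha) hfin hle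
  by_contra! hlt
  have hopen : IsOpen {x | a < x ∧ r < x ∧ |2 * a - x| < r ∧ V (2 * a - x) < V x} := by
    refine (isOpen_lt ?_ ?_).and ((isOpen_lt ?_ ?_).and ((isOpen_lt ?_ ?_).and
      (isOpen_lt ?_ ?_))) <;> fun_prop
  obtain ⟨x, hx, hax, hrx, hxr, hlt⟩ :=
    (Measure.dense_of_ae hae).exists_mem_open hopen ⟨y, hay, hry, hyr, hlt⟩
  have hsq := (ENNReal.ofReal_le_ofReal_iff (sq_nonneg _)).1
    (hx hax (hrx.trans_le (le_abs_self x)) hxr.not_gt)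
  exact hsq.not_gt (pow_lt_pow_left₀ hlt (h0 _) two_ne_zero)

section Minimizer

variable {z a : ℝ} {U : ℝ → ℝ}

theorem ae_exterior_polarize_eq_of_isMinOn (hU : U ∈ unitLocAC) (h0 : ∀ x, 0 ≤ U x)
    (hE : eenergy z U ≠ ⊤) (hmin : IsMinOn (eenergy z) unitLocAC U) (ha : 0 ≤ a) :
    ∀ᵐ r, 0 < r → sqMeasure (polarize a U) {x | r < |x|} = sqMeasure U {x | r < |x|} := by
  have hle := (hmin (symmetrize_polarize_mem_unitLocAC hU h0 a)).trans
    (eenergy_symmetrize_polarize_le z hU.1 h0 ha)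
  obtain ⟨hE₁, hE₂⟩ := ENNReal.add_ne_top.1 hE
  have hcoulomb := (ENNReal.add_le_add_iff_left hE₁).1 hle
  have hpt : ∀ r, sqMeasure (polarize a U) {x | r < |x|} ^ 2 / 2 ≤
      sqMeasure U {x | r < |x|} ^ 2 / 2 := fun r => by
    gcongr ?_ ^ 2 / 2
    exact sqMeasure_polarize_exterior_le hU.1.continuous.measurable h0 ha r
  have hsq := ae_eq_of_ae_le_of_lintegral_le (Eventually.of_forall hpt)
    (ne_top_of_le_ne_top hE₂ ((lintegral_mono hpt).trans
      (lintegral_sq_exterior_div_two_le_coulomb _)))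
    (((measurable_measure_exterior _).pow_const 2).div_const 2).aemeasurable
    ((lintegral_sq_exterior_div_two_le_coulomb _).trans hcoulomb)
  filter_upwards [(ae_restrict_iff' measurableSet_Ioi).1 hsq] with r hr hr0
  have hr := hr hr0
  simp only [ENNReal.div_eq_inv_mul] at hr
  exact (ENNReal.pow_right_strictMono two_ne_zero).injective
    ((ENNReal.mul_right_inj (by simp) (by simp)).1 hr)

theorem le_reflect_of_isMinOn (hU : U ∈ unitLocAC) (h0 : ∀ x, 0 ≤ U x) (hE : eenergy z U ≠ ⊤)
    (hmin : IsMinOn (eenergy z) unitLocAC U) (ha : 0 < a) {y : ℝ} (hay : a < y) :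
    U y ≤ U (2 * a - y) := by
  have hae := ae_exterior_polarize_eq_of_isMinOn hU h0 hE hmin ha.le
  obtain ⟨r, hr, hyr, hry⟩ := (Measure.dense_of_ae hae).exists_between
    (abs_lt.2 ⟨by linarith, by linarith⟩ : |2 * a - y| < y)
  exact le_reflect_of_exterior_le_polarize hU.1.continuous h0 ha.le
    (ne_top_of_le_ne_top ENNReal.one_ne_top (hU.2 ▸ measure_mono (subset_univ _)))
    (hr ((abs_nonneg _).trans_lt hyr)).ge hay hry hyr

theorem le_of_abs_lt_of_isMinOn (hU : U ∈ unitLocAC) (h0 : ∀ x, 0 ≤ U x)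
    (hE : eenergy z U ≠ ⊤) (hmin : IsMinOn (eenergy z) unitLocAC U) {x y : ℝ} (hxy : |x| < y) :
    U y ≤ U x := by
  have hlt := abs_lt.1 hxy
  have h := le_reflect_of_isMinOn (a := (x + y) / 2) hU h0 hE hmin (by linarith) (y := y)
    (by linarith)
  rwa [mul_div_cancel₀ _ two_ne_zero, add_sub_cancel_right] at h

end Minimizer

theorem isSymmNonincreasing_of_forall_abs_lt {F : ℝ → ℝ} (hF : Continuous F)
    (h : ∀ x y, |x| < |y| → F y ≤ F x) : IsSymmNonincreasing F := by
  have hle : ∀ x, F x ≤ F (-x) := fun x => by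
    rcases eq_or_ne x 0 with rfl | hx
    · rw [neg_zero]
    have hlim : Tendsto (fun t : ℝ => F (t * x)) (𝓝[>] 1) (𝓝 (F x)) :=
      ((hF.comp (continuous_mul_const x)).tendsto' 1 (F x) (by simp)).mono_left
        nhdsWithin_le_nhds
    refine le_of_tendsto hlim (eventually_mem_nhdsWithin.mono fun t (ht : 1 < t) => h _ _ ?_)
    rw [abs_neg, abs_mul, abs_of_pos (one_pos.trans ht)]
    exact lt_mul_of_one_lt_left (abs_pos.2 hx) ht
  refine ⟨fun x => (by simpa using hle (-x) : F (-x) ≤ F x).antisymm (hle x), ?_⟩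
  intro x hx y hy hxy
  rcases hxy.eq_or_lt with rfl | hlt
  · exact le_rfl
  · exact h x y (by rwa [abs_of_nonneg hx, abs_of_nonneg hy])

theorem isSymmNonincreasing_of_isMinOn {z : ℝ} {U : ℝ → ℝ} (hU : U ∈ unitLocAC)
    (h0 : ∀ x, 0 ≤ U x) (hE : eenergy z U ≠ ⊤) (hmin : IsMinOn (eenergy z) unitLocAC U) :
    IsSymmNonincreasing U := by
  refine isSymmNonincreasing_of_forall_abs_lt hU.1.continuous fun x y hxy => ?_
  rcases lt_abs.1 hxy with h | h
  · exact le_of_abs_lt_of_isMinOn hU h0 hE hmin h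
  · have hneg := eenergy_comp_neg z U
    have := le_of_abs_lt_of_isMinOn (comp_neg_mem_unitLocAC hU) (fun _ => h0 _) (hneg ▸ hE)
      (fun W hW => hneg.trans_le (hmin hW)) (abs_neg x ▸ h)
    simpa only [neg_neg] using this

theorem IsSymmNonincreasing.le_of_abs_le {v : ℝ → ℝ} (hv : IsSymmNonincreasing v) {x y : ℝ}
    (hxy : |x| ≤ |y|) : v y ≤ v x := by
  have habs : ∀ t, v |t| = v t := fun t => by
    rcases abs_choice t with h | h <;> rw [h]
    exact hv.1 t
  rw [← habs x, ← habs y]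
  exact hv.2 (abs_nonneg x) (abs_nonneg y) hxy

theorem IsSymmNonincreasing.nonneg_of_abs {V : ℝ → ℝ} (hV : Continuous V)
    (h : IsSymmNonincreasing fun x => |V x|) (h0 : 0 ≤ V 0) (x : ℝ) : 0 ≤ V x := by
  by_contra! hx
  obtain ⟨t, ht, ht0⟩ := intermediate_value_uIcc hV.continuousOn
    (mem_uIcc.2 (.inr ⟨hx.le, h0⟩) : (0 : ℝ) ∈ uIcc (V 0) (V x))
  have htx : |V x| ≤ |V t| := h.le_of_abs_le (by simpa using abs_sub_left_of_mem_uIcc ht)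
  rw [ht0, abs_zero] at htx
  exact hx.ne (abs_nonpos_iff.1 htx)

theorem eq_abs_or_eq_neg_abs {V : ℝ → ℝ} (hV : Continuous V)
    (h : IsSymmNonincreasing fun x => |V x|) : (∀ x, V x = |V x|) ∨ ∀ x, V x = -|V x| := by
  rcases le_total 0 (V 0) with h0 | h0
  · exact .inl fun x => (abs_of_nonneg (h.nonneg_of_abs hV h0 x)).symm
  · refine .inr fun x => ?_
    have hneg := IsSymmNonincreasing.nonneg_of_abs hV.neg
      (by simpa only [Pi.neg_apply, abs_neg] using h) (neg_nonneg.2 h0) x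
    rw [abs_of_nonpos (neg_nonneg.1 hneg), neg_neg]

/-! ### Reduction of the energy to its extended nonnegative form -/

theorem H1_congr {u v : ℝ → ℝ} (h : u =ᵐ[volume] v) (hu : u ∈ H1) : v ∈ H1 := by
  obtain ⟨hu2, g, hg, hug⟩ := hu
  exact ⟨hu2.ae_eq h, g, hg, hug.congr h .rfl⟩

theorem ae_prod_eq_and_eq {u v : ℝ → ℝ} (h : u =ᵐ[volume] v) :
    ∀ᵐ p : ℝ × ℝ, u p.1 = v p.1 ∧ u p.2 = v p.2 :=
  (Measure.quasiMeasurePreserving_fst.ae_eq_comp h).and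
    (Measure.quasiMeasurePreserving_snd.ae_eq_comp h)

theorem energy_congr (z : ℝ) {u v : ℝ → ℝ} (h : u =ᵐ[volume] v) (hu : u ∈ H1) :
    energy z u = energy z v := by
  have hd : weakDeriv v =ᵐ[volume] weakDeriv u :=
    weakDeriv_ae_eq (H1_congr h hu) ((weakDeriv_spec hu).2.congr h .rfl)
  unfold energy potentialEnergy
  congr 1
  · exact integral_congr_ae (hd.mono fun x hx => by simp only [hx])
  · congr 1
    exact integral_congr_ae ((ae_prod_eq_and_eq h).mono fun p hp => by simp only [hp.1, hp.2])

/-- The domain of the minimisation problem, uniformly in `z`: the moment condition is void for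
`z = 1`. -/
def admissible (z : ℝ) : Set (ℝ → ℝ) :=
  {u | u ∈ H1 ∧ ∫ x, u x ^ 2 = 1 ∧ Integrable (fun x => (z - 1) * (|x| * u x ^ 2)) ∧
    Integrable fun p : ℝ × ℝ => G p.1 p.2 * u p.1 ^ 2 * u p.2 ^ 2}

theorem admissible_congr {z : ℝ} {u v : ℝ → ℝ} (h : u =ᵐ[volume] v) (hu : u ∈ admissible z) :
    v ∈ admissible z := by
  obtain ⟨hH, h1, hx, hG⟩ := hu
  refine ⟨H1_congr h hH, ?_, hx.congr ?_, hG.congr ?_⟩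
  · exact (integral_congr_ae (h.mono fun x hx => by simp only [hx])).symm.trans h1
  · exact h.mono fun x hx => by simp only [hx]
  · exact (ae_prod_eq_and_eq h).mono fun p hp => by simp only [hp.1, hp.2]

theorem G_mul_sq_mul_sq_nonneg (u : ℝ → ℝ) (p : ℝ × ℝ) :
    0 ≤ G p.1 p.2 * u p.1 ^ 2 * u p.2 ^ 2 :=
  mul_nonneg (mul_nonneg (G_nonneg _ _) (sq_nonneg _)) (sq_nonneg _)

theorem integrable_G_mul_sq_mul_sq {u : ℝ → ℝ} (hu : MemLp u 2)
    (hx : Integrable fun x => |x| * u x ^ 2) :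
    Integrable fun p : ℝ × ℝ => G p.1 p.2 * u p.1 ^ 2 * u p.2 ^ 2 := by
  have hmeas : AEStronglyMeasurable fun p : ℝ × ℝ => G p.1 p.2 * (u p.1 ^ 2 * u p.2 ^ 2) :=
    continuous_G.aestronglyMeasurable.mul
      (hu.integrable_sq.mul_prod hu.integrable_sq).aestronglyMeasurable
  simp only [← mul_assoc] at hmeas
  refine (hx.mul_prod hu.integrable_sq).mono' hmeas (Eventually.of_forall fun p => ?_)
  rw [Real.norm_of_nonneg (G_mul_sq_mul_sq_nonneg u p)]
  gcongr
  exact G_le_abs p.1 p.2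

theorem normalized_spaceX_eq_admissible {z : ℝ} (hz : z ≠ 1) :
    normalized spaceX = admissible z := by
  ext u
  simp only [admissible, mem_ofPred_eq,
    integrable_const_mul_iff (isUnit_iff_ne_zero.2 (sub_ne_zero.2 hz))]
  exact ⟨fun ⟨⟨hH, hx⟩, h1⟩ => ⟨hH, h1, hx, integrable_G_mul_sq_mul_sq hH.1 hx⟩,
    fun ⟨hH, h1, hx, _⟩ => ⟨⟨hH, hx⟩, h1⟩⟩

theorem normalized_spaceB_eq_admissible : normalized spaceB = admissible 1 := by
  ext u
  simp only [admissible, mem_ofPred_eq, sub_self, zero_mul]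
  exact ⟨fun ⟨⟨hH, hG⟩, h1⟩ => ⟨hH, h1, integrable_zero _ _ _, hG⟩,
    fun ⟨hH, h1, _, hG⟩ => ⟨⟨hH, hG⟩, h1⟩⟩

theorem potentialEnergy_sq_of_mem_admissible {z : ℝ} {u : ℝ → ℝ} (hu : u ∈ admissible z) :
    potentialEnergy z (fun x => u x ^ 2) = (∫ x, (z - 1) * (|x| * u x ^ 2)) +
      ∫ p : ℝ × ℝ, G p.1 p.2 * u p.1 ^ 2 * u p.2 ^ 2 := by
  obtain ⟨hH, h1, hx, hG⟩ := hu
  have hsq := hH.1.integrable_sq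
  have hA : Integrable fun p : ℝ × ℝ => (z - 1) * (|p.1| * u p.1 ^ 2) * u p.2 ^ 2 :=
    hx.mul_prod hsq
  have hB : Integrable fun p : ℝ × ℝ => u p.1 ^ 2 * ((z - 1) * (|p.2| * u p.2 ^ 2)) :=
    hsq.mul_prod hx
  have hAB : Integrable fun p : ℝ × ℝ =>
      (z - 1) * (|p.1| * u p.1 ^ 2) * u p.2 ^ 2 + u p.1 ^ 2 * ((z - 1) * (|p.2| * u p.2 ^ 2)) :=
    hA.add hB
  have hA_eq := integral_prod_mul (μ := volume) (ν := volume)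
    (fun x => (z - 1) * (|x| * u x ^ 2)) fun y => u y ^ 2
  have hB_eq := integral_prod_mul (μ := volume) (ν := volume)
    (fun x => u x ^ 2) fun y => (z - 1) * (|y| * u y ^ 2)
  rw [h1, mul_one, ← Measure.volume_eq_prod] at hA_eq
  rw [h1, one_mul, ← Measure.volume_eq_prod] at hB_eq
  have hsplit : ∀ p : ℝ × ℝ, (z * (|p.1| + |p.2|) - |p.1 - p.2|) * u p.1 ^ 2 * u p.2 ^ 2 =
      ((z - 1) * (|p.1| * u p.1 ^ 2) * u p.2 ^ 2 + u p.1 ^ 2 * ((z - 1) * (|p.2| * u p.2 ^ 2))) +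
        2 * (G p.1 p.2 * u p.1 ^ 2 * u p.2 ^ 2) := fun p => by unfold G; ring
  unfold potentialEnergy
  simp only [hsplit]
  rw [integral_add hAB (hG.const_mul 2), integral_add hA hB, hA_eq, hB_eq,
    integral_const_mul (2 : ℝ)]
  ring

section ExtendedEnergy

variable {V : ℝ → ℝ}

theorem ofReal_mul_absMoment_sqMeasure (hV : Measurable V) {c : ℝ} (hc : 0 ≤ c) :
    ENNReal.ofReal c * absMoment (sqMeasure V) =
      ∫⁻ x, ENNReal.ofReal (c * (|x| * V x ^ 2)) := by
  rw [absMoment, sqMeasure, lintegral_withDensity_eq_lintegral_mul _ (by fun_prop) (by fun_prop),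
    ← lintegral_const_mul _ (by fun_prop)]
  refine lintegral_congr fun x => ?_
  rw [ENNReal.ofReal_mul hc, ENNReal.ofReal_mul (abs_nonneg x), Pi.mul_apply, mul_comm]
  ring

theorem coulomb_sqMeasure (hV : Measurable V) :
    coulomb (sqMeasure V) =
      ∫⁻ p : ℝ × ℝ, ENNReal.ofReal (G p.1 p.2 * V p.1 ^ 2 * V p.2 ^ 2) := by
  have hG := continuous_G.measurable
  rw [coulomb, sqMeasure, prod_withDensity (by fun_prop) (by fun_prop),
    lintegral_withDensity_eq_lintegral_mul _ (by fun_prop) (by fun_prop)]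
  refine lintegral_congr fun p => ?_
  rw [Pi.mul_apply, ENNReal.ofReal_mul (mul_nonneg (G_nonneg _ _) (sq_nonneg _)),
    ENNReal.ofReal_mul (G_nonneg _ _)]
  ring

theorem integral_sq_eq_one_iff (hV : Measurable V) :
    ∫ x, V x ^ 2 = 1 ↔ sqMeasure V univ = 1 := by
  rw [integral_eq_lintegral_of_nonneg_ae (Eventually.of_forall fun x => sq_nonneg _)
    (by fun_prop), ENNReal.toReal_eq_one_iff, sqMeasure_apply, Measure.restrict_univ]

theorem measurable_G_mul_sq_mul_sq (hV : Measurable V) :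
    Measurable fun p : ℝ × ℝ => G p.1 p.2 * V p.1 ^ 2 * V p.2 ^ 2 := by
  have hG := continuous_G.measurable
  fun_prop

theorem sub_one_mul_abs_mul_sq_nonneg {z : ℝ} (hz : 1 ≤ z) (V : ℝ → ℝ) (x : ℝ) :
    0 ≤ (z - 1) * (|x| * V x ^ 2) :=
  mul_nonneg (sub_nonneg.2 hz) (mul_nonneg (abs_nonneg x) (sq_nonneg _))

theorem mem_admissible_iff {z : ℝ} (hz : 1 ≤ z) (hV : IsLocAC V) :
    V ∈ admissible z ↔ V ∈ unitLocAC ∧ eenergy z V ≠ ⊤ := by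
  have hm := hV.continuous.measurable
  have hd := measurable_deriv V
  have hfinite : ∫ x, V x ^ 2 = 1 → Integrable fun x => V x ^ 2 := fun h =>
    .of_integral_ne_zero (h ▸ one_ne_zero)
  rw [eenergy, ENNReal.add_ne_top, ENNReal.add_ne_top, dirichlet,
    ofReal_mul_absMoment_sqMeasure hm (sub_nonneg.2 hz), coulomb_sqMeasure hm,
    lintegral_ofReal_ne_top_iff_integrable (by fun_prop) (.of_forall fun _ => sq_nonneg _),
    lintegral_ofReal_ne_top_iff_integrable (by fun_prop)
      (.of_forall (sub_one_mul_abs_mul_sq_nonneg hz V)),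
    lintegral_ofReal_ne_top_iff_integrable (measurable_G_mul_sq_mul_sq hm).aestronglyMeasurable
      (.of_forall (G_mul_sq_mul_sq_nonneg V))]
  simp only [admissible, unitLocAC, mem_ofPred_eq, hV.mem_H1_iff, hV, true_and,
    memLp_two_iff_integrable_sq hm.aestronglyMeasurable,
    memLp_two_iff_integrable_sq hd.aestronglyMeasurable, integral_sq_eq_one_iff hm] at hfinite ⊢
  tauto

theorem energy_eq_toReal_eenergy {z : ℝ} (hz : 1 ≤ z) (hV : IsLocAC V)
    (ha : V ∈ admissible z) : energy z V = (eenergy z V).toReal := by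
  have hm := hV.continuous.measurable
  obtain ⟨hdx, hG⟩ := ENNReal.add_ne_top.1 ((mem_admissible_iff hz hV).1 ha).2
  obtain ⟨hdir, hx⟩ := ENNReal.add_ne_top.1 hdx
  have hweak : ∫ x, weakDeriv V x ^ 2 = ∫ x, deriv V x ^ 2 :=
    integral_congr_ae ((weakDeriv_ae_eq ha.1 hV.isWeakDeriv).mono fun x hx => by simp only [hx])
  rw [energy, hweak, potentialEnergy_sq_of_mem_admissible ha, eenergy,
    ENNReal.toReal_add hdx hG, ENNReal.toReal_add hdir hx, add_assoc, dirichlet,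
    ofReal_mul_absMoment_sqMeasure hm (sub_nonneg.2 hz), coulomb_sqMeasure hm,
    integral_eq_lintegral_of_nonneg_ae (.of_forall fun _ => sq_nonneg _) (by fun_prop),
    integral_eq_lintegral_of_nonneg_ae (.of_forall (sub_one_mul_abs_mul_sq_nonneg hz V))
      (by fun_prop),
    integral_eq_lintegral_of_nonneg_ae (.of_forall (G_mul_sq_mul_sq_nonneg V))
      (measurable_G_mul_sq_mul_sq hm).aestronglyMeasurable]

theorem isMinOn_eenergy {z : ℝ} (hz : 1 ≤ z) (hV : IsLocAC V) (ha : V ∈ admissible z)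
    (hmin : IsMinOn (energy z) (admissible z) V) : IsMinOn (eenergy z) unitLocAC V := by
  intro W hW
  by_cases hWE : eenergy z W = ⊤
  · exact le_top.trans_eq hWE.symm
  have hWa := (mem_admissible_iff hz hW.1).2 ⟨hW, hWE⟩
  have hle : energy z V ≤ energy z W := hmin hWa
  rw [energy_eq_toReal_eenergy hz hV ha, energy_eq_toReal_eenergy hz hW.1 hWa] at hle
  exact (ENNReal.toReal_le_toReal ((mem_admissible_iff hz hV).1 ha).2 hWE).1 hle

end ExtendedEnergy

theorem IsLocAC.isSymmNonincreasing_abs_of_isMinOn {z : ℝ} (hz : 1 ≤ z) {V : ℝ → ℝ}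
    (hV : IsLocAC V) (ha : V ∈ admissible z) (hmin : IsMinOn (energy z) (admissible z) V) :
    IsSymmNonincreasing fun x => |V x| := by
  obtain ⟨hV1, hVE⟩ := (mem_admissible_iff hz hV).1 ha
  have habs := eenergy_abs_le z hV
  exact isSymmNonincreasing_of_isMinOn (abs_mem_unitLocAC hV1) (fun _ => abs_nonneg _)
    (ne_top_of_le_ne_top hVE habs) fun W hW => habs.trans (isMinOn_eenergy hz hV ha hmin hW)

theorem exists_isSymmNonincreasing_of_isMinOn {z : ℝ} (hz : 1 ≤ z) {u : ℝ → ℝ}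
    (hu : u ∈ admissible z) (hmin : IsMinOn (energy z) (admissible z) u) :
    ∃ v : ℝ → ℝ, Continuous v ∧ (∀ x, 0 ≤ v x) ∧ IsSymmNonincreasing v ∧
      (u =ᵐ[volume] v ∨ u =ᵐ[volume] -v) := by
  obtain ⟨g, -, hug⟩ := hu.1.2
  obtain ⟨V, hV, huV, -⟩ := hug.exists_isLocAC_ae_eq
  have hminV : IsMinOn (energy z) (admissible z) V := fun w hw =>
    (energy_congr z huV hu.1).ge.trans (hmin hw)
  have hsymm := hV.isSymmNonincreasing_abs_of_isMinOn hz (admissible_congr huV hu) hminV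
  refine ⟨_, hV.abs.continuous, fun _ => abs_nonneg _, hsymm, ?_⟩
  exact (eq_abs_or_eq_neg_abs hV.continuous hsymm).imp
    (fun h => huV.mono fun x hx => hx.trans (h x)) fun h => huV.mono fun x hx => hx.trans (h x)

end HydrogenLikeAtom

theorem mainTheorem5 (z : ℝ) (u : ℝ → ℝ)
    (hu : (1 < z ∧ u ∈ HydrogenLikeAtom.normalized HydrogenLikeAtom.spaceX ∧
            IsMinOn (HydrogenLikeAtom.energy z)
              (HydrogenLikeAtom.normalized HydrogenLikeAtom.spaceX) u) ∨
          (z = 1 ∧ u ∈ HydrogenLikeAtom.normalized HydrogenLikeAtom.spaceB ∧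
            IsMinOn (HydrogenLikeAtom.energy z)
              (HydrogenLikeAtom.normalized HydrogenLikeAtom.spaceB) u)) :
    ∃ v : ℝ → ℝ, Continuous v ∧ (∀ x, 0 ≤ v x) ∧ HydrogenLikeAtom.IsSymmNonincreasing v ∧
      (u =ᵐ[volume] v ∨ u =ᵐ[volume] -v) := by
  obtain ⟨hz, hu, hmin⟩ : 1 ≤ z ∧ u ∈ HydrogenLikeAtom.admissible z ∧
      IsMinOn (HydrogenLikeAtom.energy z) (HydrogenLikeAtom.admissible z) u := by
    rcases hu with ⟨hz, hu⟩ | ⟨rfl, hu⟩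
    · rw [← HydrogenLikeAtom.normalized_spaceX_eq_admissible hz.ne']
      exact ⟨hz.le, hu⟩
    · rw [← HydrogenLikeAtom.normalized_spaceB_eq_admissible]
      exact ⟨le_rfl, hu⟩
  exact HydrogenLikeAtom.exists_isSymmNonincreasing_of_isMinOn hz hu hmin
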